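/- Consider three bosonic modes with annihilation operators $\hat a_i=\frac1{\sqrt2}(x_i+\partial_{x_i})$ and creation operators $\hat a_i^\dagger=\frac1{\sqrt2}(x_i-\partial_{x_i})$, $i=1,2,3$, acting on wave functions on $\mathbb R^3$. For a normalised wave function $\psi$ and $\{i,j,k\}=\{1,2,3\}$ put $$\mathcal A^{(m)}_{i|jk}=\frac1{m!}\bigl\langle\psi\bigm|(\hat a_i^\dagger+\hat a_j+\hat a_k)^m(\hat a_i+\hat a_j^\dagger+\hat a_k^\dagger)^m\bigm|\psi\bigr\rangle,\qquad S^{(m)}_3=\tfrac13\bigl(\mathcal A^{(m)}_{1|23}+\mathcal A^{(m)}_{2|13}+\mathcal A^{(m)}_{3|12}\bigr).$$ For $a>1$ let $e_\pm=\dfrac{a^2-1\pm\sqrt{(a^2-1)(9a^2-1)}}{4a}$, let $A_a$ be the (positive definite) $3\times3$ matrix with diagonal entries $a$ and off-diagonal entries $e_+$ (its inverse has diagonal entries $a$ and off-diagonal entries $e_-$), and let the GHZ/W state $|\varphi_a\rangle$ be the pure Gaussian state with wave function $$\varphi_a(x)=\pi^{-3/4}(\det A_a)^{1/4}\exp\bigl(-\tfrac12x^{\mathrm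 T}A_ax\bigr).$$ Let $$E_m(x)=4^{-m}\sum_{k=0}^m\binom{2k}{k}\binom{2m-2k}{m-k}x^k,\qquad \alpha=\frac{27-\sqrt{385}}8,\qquad \beta=\frac{61-\sqrt{385}}{24}.$$ Then the following hold. 1. For the state $|\varphi_{3/2}\rangle$, $S^{(m)}_3=\beta^mE_m(\alpha/\beta)$ for every $m\ge0$, and $0\le\alpha/\beta<1$. 2. For every $x$ with $0\le x<1$, the sequence $E_m(x)$, $m\ge0$, is strictly decreasing in $m$. 3. The state $|\varphi_{3/2}\rangle$ violates the biseparability bound $S^{(m)}_3\ge(2^m+2)/3$ for every $m\ge1$, that is, $S^{(m)}_3<(2^m+2)/3$. 4. The violation grows at least like $(2/\beta)^m$: there is a constant $C>0$ such that $\dfrac{(2^m+2)/3}{S^{(m)}_3}\ge C\,(2/\beta)^m$ for all $m\ge1$. Here $1.16<2/\beta<1.17$. -/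

import Mathlib

open scoped SchwartzMap Matrix Nat LineDeriv ComplexConjugate ContDiff

noncomputable section

/-! ## Three bosonic modes in the position representation -/

/-- The configuration space `ℝ³` of three modes, one coordinate for each of the modes `a, b, c`. -/
abbrev Config := EuclideanSpace ℝ (Fin 3)

/-- Multiplication by the `i`-th coordinate, the position operator of the mode `i`
(with `ℏ = 1`). -/
def positionOp (i : Fin 3) : 𝓢(Config, ℂ) →L[ℂ] 𝓢(Config, ℂ) :=
  SchwartzMap.smulLeftCLM ℂ (fun x : Config => ((x i : ℝ) : ℂ))

/-- The partial derivative `∂ / ∂xᵢ`. -/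
def partialOp (i : Fin 3) : 𝓢(Config, ℂ) →L[ℂ] 𝓢(Config, ℂ) :=
  LineDeriv.lineDerivOpCLM ℂ 𝓢(Config, ℂ) (EuclideanSpace.single i (1 : ℝ))

/-- The annihilation operator `(xᵢ + ∂ᵢ) / √2` of the mode `i`. -/
def annihilate (i : Fin 3) : 𝓢(Config, ℂ) →L[ℂ] 𝓢(Config, ℂ) :=
  ((1 / √2 : ℝ) : ℂ) • (positionOp i + partialOp i)

/-- The creation operator `(xᵢ - ∂ᵢ) / √2` of the mode `i`. -/
def create (i : Fin 3) : 𝓢(Config, ℂ) →L[ℂ] 𝓢(Config, ℂ) :=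
  ((1 / √2 : ℝ) : ℂ) • (positionOp i - partialOp i)

lemma coord_hasTemperateGrowth (i : Fin 3) :
    Function.HasTemperateGrowth (fun x : Config => ((x i : ℝ) : ℂ)) := by
  have h : (fun x : Config => ((x i : ℝ) : ℂ)) =
      (Complex.ofRealCLM ∘L (EuclideanSpace.proj i : Config →L[ℝ] ℝ)) := by
    ext x; simp
  rw [h]
  exact ContinuousLinearMap.hasTemperateGrowth _

lemma positionOp_apply (i : Fin 3) (f : 𝓢(Config, ℂ)) (x : Config) :
    positionOp i f x = (x i : ℂ) * f x := by
  simp [positionOp, SchwartzMap.smulLeftCLM_apply_apply (coord_hasTemperateGrowth i)]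

lemma partialOp_apply (i : Fin 3) (f : 𝓢(Config, ℂ)) (x : Config) :
    partialOp i f x = lineDeriv ℝ f x (EuclideanSpace.single i (1 : ℝ)) := by
  rw [partialOp, LineDeriv.lineDerivOpCLM_apply, SchwartzMap.lineDerivOp_apply]

/-- The expectation value `⟨ψ, T ψ⟩` of the operator `T` in the state with the normalised wave
function `ψ`. -/
def expectation (ψ : 𝓢(Config, ℂ)) (T : 𝓢(Config, ℂ) →L[ℂ] 𝓢(Config, ℂ)) : ℂ :=
  ∫ x : Config, conj (ψ x) * T ψ x

/-- `𝒜⁽ᵐ⁾_{i|jk} = (1 / m!) ⟨(aᵢ† + aⱼ + aₖ)ᵐ (aᵢ + aⱼ† + aₖ†)ᵐ⟩`. -/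
def momentA (ψ : 𝓢(Config, ℂ)) (m : ℕ) (i j k : Fin 3) : ℂ :=
  (1 / (m ! : ℂ)) * expectation ψ
    ((create i + annihilate j + annihilate k) ^ m * (annihilate i + create j + create k) ^ m)

/-- `S⁽ᵐ⁾₃ = (𝒜⁽ᵐ⁾_{1|23} + 𝒜⁽ᵐ⁾_{2|13} + 𝒜⁽ᵐ⁾_{3|12}) / 3`. -/
def momentS (ψ : 𝓢(Config, ℂ)) (m : ℕ) : ℂ :=
  (1 / 3) * (momentA ψ m 0 1 2 + momentA ψ m 1 0 2 + momentA ψ m 2 0 1)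

/-! ## Real pure Gaussian states -/

/-- The quadratic form `xᵀ A x`. -/
def quadForm (A : Matrix (Fin 3) (Fin 3) ℝ) (x : Config) : ℝ := x.ofLp ⬝ᵥ (A *ᵥ x.ofLp)

lemma quadForm_hasTemperateGrowth (A : Matrix (Fin 3) (Fin 3) ℝ) :
    Function.HasTemperateGrowth (quadForm A) := by
  have hc : ∀ i : Fin 3, Function.HasTemperateGrowth (fun x : Config => x i) := fun i =>
    (EuclideanSpace.proj i : Config →L[ℝ] ℝ).hasTemperateGrowth
  have h : quadForm A = fun x : Config => ∑ i, x i * ∑ j, A i j * x j := by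
    ext x; simp [quadForm, dotProduct, Matrix.mulVec]
  rw [h]
  refine Function.HasTemperateGrowth.sum fun i _ => (hc i).mul ?_
  exact Function.HasTemperateGrowth.sum fun j _ => (Function.HasTemperateGrowth.const _).mul (hc j)

lemma quadForm_coercive {A : Matrix (Fin 3) (Fin 3) ℝ} (hA : A.PosDef) :
    ∃ c : ℝ, 0 < c ∧ ∀ x : Config, c * ‖x‖ ^ 2 ≤ quadForm A x := by
  have hcont : Continuous (quadForm A) := (quadForm_hasTemperateGrowth A).1.continuous
  have hpos : ∀ x : Config, x ≠ 0 → 0 < quadForm A x := fun x hx => by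
    have := hA.dotProduct_mulVec_pos (x := x.ofLp) (by simpa using hx)
    simpa [quadForm] using this
  have hne : (Metric.sphere (0 : Config) 1).Nonempty := NormedSpace.sphere_nonempty.2 zero_le_one
  obtain ⟨y, hy, hmin⟩ := (isCompact_sphere (0 : Config) 1).exists_isMinOn hne hcont.continuousOn
  have hy1 : ‖y‖ = 1 := by simpa using hy
  refine ⟨quadForm A y, hpos y (by rintro rfl; simp at hy1), fun x => ?_⟩
  by_cases hx : x = 0
  · subst hx; simp [quadForm]
  have hx' : ‖x‖ ≠ 0 := norm_ne_zero_iff.2 hx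
  have h1 := hmin (show ‖x‖⁻¹ • x ∈ Metric.sphere (0 : Config) 1 by simp [norm_smul, hx'])
  have h2 : quadForm A (‖x‖⁻¹ • x) = (‖x‖ ^ 2)⁻¹ * quadForm A x := by
    simp [quadForm, Matrix.mulVec_smul]; ring
  have h3 : quadForm A y ≤ (‖x‖ ^ 2)⁻¹ * quadForm A x := by rw [← h2]; exact h1
  rw [inv_mul_eq_div, le_div_iff₀ (by positivity)] at h3
  exact h3

lemma one_add_pow_mul_exp_le (p : ℕ) {c : ℝ} (hc : 0 < c) :
    ∃ K : ℝ, ∀ r : ℝ, 0 ≤ r → (1 + r) ^ p * Real.exp (-(c * r ^ 2)) ≤ K := by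
  refine ⟨2 ^ p * (p ! * Real.exp c / c ^ p), fun r hr => ?_⟩
  have h1 : (1 + r) ^ p ≤ (2 * (1 + r ^ 2)) ^ p := by
    gcongr; nlinarith [sq_nonneg (r - 1)]
  have h2 := Real.pow_div_factorial_le_exp (c * (1 + r ^ 2)) (by positivity) p
  rw [div_le_iff₀ (by positivity), mul_pow] at h2
  have h3 : (1 + r ^ 2) ^ p ≤ p ! * Real.exp c / c ^ p * Real.exp (c * r ^ 2) := by
    rw [div_mul_eq_mul_div, le_div_iff₀ (by positivity)]
    calc (1 + r ^ 2) ^ p * c ^ p = c ^ p * (1 + r ^ 2) ^ p := mul_comm _ _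
      _ ≤ Real.exp (c * (1 + r ^ 2)) * p ! := h2
      _ = p ! * Real.exp c * Real.exp (c * r ^ 2) := by
        rw [mul_add, mul_one, Real.exp_add]; ring
  calc (1 + r) ^ p * Real.exp (-(c * r ^ 2))
      ≤ (2 * (1 + r ^ 2)) ^ p * Real.exp (-(c * r ^ 2)) := by gcongr
    _ ≤ (2 ^ p * (p ! * Real.exp c / c ^ p * Real.exp (c * r ^ 2))) *
          Real.exp (-(c * r ^ 2)) := by rw [mul_pow]; gcongr
    _ = 2 ^ p * (p ! * Real.exp c / c ^ p) := by
      rw [Real.exp_neg]; field_simp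

lemma gaussian_decay {A : Matrix (Fin 3) (Fin 3) ℝ} (hA : A.PosDef) (k n : ℕ) :
    ∃ C : ℝ, ∀ x : Config, ‖x‖ ^ k *
      ‖iteratedFDeriv ℝ n (fun x : Config => Real.exp (-(1 / 2) * quadForm A x)) x‖ ≤ C := by
  obtain ⟨c, hc, hcoer⟩ := quadForm_coercive hA
  have hf : Function.HasTemperateGrowth (fun x : Config => -(1 / 2) * quadForm A x) :=
    (Function.HasTemperateGrowth.const _).mul (quadForm_hasTemperateGrowth A)
  obtain ⟨l, D, hD0, hD⟩ := hf.norm_iteratedFDeriv_le_uniform n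
  obtain ⟨K, hK⟩ := one_add_pow_mul_exp_le (k + l * n) (half_pos hc)
  refine ⟨n ! * (1 + D) ^ n * K, fun x => ?_⟩
  have hr := norm_nonneg x
  have hexp : Real.exp (-(1 / 2) * quadForm A x) ≤ Real.exp (-(c / 2 * ‖x‖ ^ 2)) :=
    Real.exp_le_exp.2 (by linarith [hcoer x])
  have key := norm_iteratedFDeriv_comp_le (n := n) (N := ∞) (g := Real.exp)
    (f := fun x : Config => -(1 / 2) * quadForm A x)
    Real.contDiff_exp hf.1 (mod_cast le_top) x
    (C := Real.exp (-(c / 2 * ‖x‖ ^ 2))) (D := (1 + D) * (1 + ‖x‖) ^ l)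
    (fun i _ => by
      rw [norm_iteratedFDeriv_eq_norm_iteratedDeriv, iteratedDeriv_eq_iterate,
        Real.iter_deriv_exp, Real.norm_eq_abs, Real.abs_exp]
      exact hexp)
    (fun i hi hin => by
      have h1 : (1 : ℝ) ≤ (1 + D) * (1 + ‖x‖) ^ l :=
        one_le_mul_of_one_le_of_one_le (by linarith) (one_le_pow₀ (by linarith))
      calc _ ≤ D * (1 + ‖x‖) ^ l := hD i hin x
        _ ≤ (1 + D) * (1 + ‖x‖) ^ l := by gcongr; linarith
        _ ≤ _ := le_self_pow₀ h1 (by omega))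
  calc _ ≤ (1 + ‖x‖) ^ k * (n ! * Real.exp (-(c / 2 * ‖x‖ ^ 2)) *
        ((1 + D) * (1 + ‖x‖) ^ l) ^ n) := by
        gcongr
        · linarith
        · exact key
    _ = n ! * (1 + D) ^ n *
          ((1 + ‖x‖) ^ (k + l * n) * Real.exp (-(c / 2 * ‖x‖ ^ 2))) := by
        rw [mul_pow, pow_add, pow_mul]; ring
    _ ≤ _ := by gcongr; exact hK _ hr

/-- The function `exp (-xᵀ A x / 2)` for a positive definite matrix `A`. -/
def gaussianFn (A : Matrix (Fin 3) (Fin 3) ℝ) (hA : A.PosDef) : 𝓢(Config, ℝ) where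
  toFun x := Real.exp (-(1 / 2) * quadForm A x)
  smooth' := Real.contDiff_exp.comp
    (contDiff_const.mul (quadForm_hasTemperateGrowth A).1)
  decay' := gaussian_decay hA

lemma gaussianFn_apply (A : Matrix (Fin 3) (Fin 3) ℝ) (hA : A.PosDef) (x : Config) :
    gaussianFn A hA x = Real.exp (-(1 / 2) * quadForm A x) := rfl

/-- The pure Gaussian state with the wave function
`π^(-3/4) (det A)^(1/4) exp (-xᵀ A x / 2)`. -/
def gaussianState (A : Matrix (Fin 3) (Fin 3) ℝ) (hA : A.PosDef) : 𝓢(Config, ℂ) :=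
  (Real.pi ^ (-(3 / 4) : ℝ) * A.det ^ (1 / 4 : ℝ)) •
    (gaussianFn A hA).postcompCLM Complex.ofRealCLM

lemma gaussianState_apply (A : Matrix (Fin 3) (Fin 3) ℝ) (hA : A.PosDef) (x : Config) :
    gaussianState A hA x = ((Real.pi ^ (-(3 / 4) : ℝ) * A.det ^ (1 / 4 : ℝ) *
      Real.exp (-(1 / 2) * (x.ofLp ⬝ᵥ (A *ᵥ x.ofLp))) : ℝ) : ℂ) := by
  simp [gaussianState, gaussianFn_apply, quadForm, SchwartzMap.postcompCLM_apply]

/-! ## The GHZ/W states -/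

/-- `e₊ = (a² - 1 + √((a² - 1)(9a² - 1))) / (4a)`. -/
def ghzwOff (a : ℝ) : ℝ := (a ^ 2 - 1 + √((a ^ 2 - 1) * (9 * a ^ 2 - 1))) / (4 * a)

/-- The matrix with diagonal entries `a` and off-diagonal entries `e₊`. -/
def ghzwMatrix (a : ℝ) : Matrix (Fin 3) (Fin 3) ℝ :=
  !![a, ghzwOff a, ghzwOff a; ghzwOff a, a, ghzwOff a; ghzwOff a, ghzwOff a, a]

lemma ghzwMatrix_posDef {a : ℝ} (ha : 1 < a) : (ghzwMatrix a).PosDef := by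
  have ha2 : 1 < a ^ 2 := by nlinarith
  have he0 : 0 < ghzwOff a := by
    have := Real.sqrt_nonneg ((a ^ 2 - 1) * (9 * a ^ 2 - 1))
    exact div_pos (by linarith) (by linarith)
  have hea : ghzwOff a < a := by
    rw [ghzwOff, div_lt_iff₀ (by linarith)]
    have : √((a ^ 2 - 1) * (9 * a ^ 2 - 1)) < 3 * a ^ 2 + 1 := by
      rw [Real.sqrt_lt' (by positivity)]
      nlinarith
    nlinarith
  refine Matrix.PosDef.of_dotProduct_mulVec_pos ?_ fun x hx => ?_
  · ext i j
    fin_cases i <;> fin_cases j <;> simp [ghzwMatrix, Matrix.conjTranspose]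
  · have hq : star x ⬝ᵥ (ghzwMatrix a *ᵥ x) =
        (a - ghzwOff a) * (x 0 ^ 2 + x 1 ^ 2 + x 2 ^ 2) +
          ghzwOff a * (x 0 + x 1 + x 2) ^ 2 := by
      simp [ghzwMatrix, Matrix.mulVec, dotProduct, Fin.sum_univ_three]
      ring
    have hn : 0 < x 0 ^ 2 + x 1 ^ 2 + x 2 ^ 2 := by
      obtain ⟨i, hi⟩ := Function.ne_iff.1 hx
      have hi2 : 0 < x i ^ 2 := by have : x i ≠ 0 := hi; positivity
      fin_cases i <;> simp at hi2 <;> positivity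
    rw [hq]
    have := mul_pos (sub_pos.2 hea) hn
    positivity

/-- The GHZ/W state `|φ_a⟩`, `a > 1`. -/
def ghzwState (a : ℝ) (ha : 1 < a) : 𝓢(Config, ℂ) :=
  gaussianState (ghzwMatrix a) (ghzwMatrix_posDef ha)

/-- `E_m(x) = 4⁻ᵐ ∑ₖ C(2k, k) C(2m - 2k, m - k) xᵏ`, the sum being over `0 ≤ k ≤ m`. -/
def polyE (m : ℕ) (x : ℝ) : ℝ :=
  (1 / 4 ^ m) * ∑ k ∈ Finset.range (m + 1),
    ((2 * k).choose k : ℝ) * ((2 * m - 2 * k).choose (m - k) : ℝ) * x ^ k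

/-- `α = (27 - √385) / 8`. -/
def alphaC : ℝ := (27 - √385) / 8

/-- `β = (61 - √385) / 24`. -/
def betaC : ℝ := (61 - √385) / 24

end

/-! The operator `aᵢ + aⱼ† + aₖ†` is `T / √2` with `T = (x₁ + x₂ + x₃) + c · ∂`, where `c` is `1` at
`i` and `-1` elsewhere, and `aᵢ† + aⱼ + aₖ` is its transpose. Since the wave function `ψ` is real,
each moment is `∫ (Tᵐ ψ)²` divided by `2ᵐ m!`.

On a Gaussian, `T ψ = V ψ` for multiplication by a linear form `V`, and `V` is the symmetric part of
an operator `K` that kills `ψ`. As `[T, V]` and `[K, T]` are scalars, the Gram matrix of the `Tⁿ ψ`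
obeys a two-term recurrence (`gram_recurrence`) and its diagonal a three-term one
(`diagonal_recurrence`). For `a = 3/2` the coefficients of the latter are built from `α + β` and
`4αβ`, whatever `i` is.

On the other side, `E_m(x)` is the coefficient of `tᵐ` in `((1 - t)(1 - xt))^(-1/2)`, and the
differential equation of this function gives `polyE_recurrence`. At `x = α/β`, scaled by `2ᵐ m! βᵐ`,
it is the same recurrence, whence `momentS_ghzwState`. It also yields `polyE_strictAnti`. The
violation follows from `β < 2` and the decrease of `E_m`, with `m = 1, 2` checked separately; its
growth follows from `E_m ≤ 1`. -/

noncomputable section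

/-! ## The polynomials `E_m` -/

/-- The coefficients `C(2k, k) / 4ᵏ` of the binomial series of `(1 - t)^(-1/2)`. -/
def centralCoeff (k : ℕ) : ℝ := (k.centralBinom : ℝ) / 4 ^ k

lemma centralCoeff_succ (k : ℕ) :
    2 * ((k : ℝ) + 1) * centralCoeff (k + 1) = (2 * k + 1) * centralCoeff k := by
  have h : ((k : ℝ) + 1) * (k + 1).centralBinom = 2 * (2 * k + 1) * k.centralBinom := by
    exact_mod_cast Nat.succ_mul_centralBinom_succ k
  simp only [centralCoeff]
  field_simp
  rw [pow_succ]
  linear_combination 2 * 4 ^ k * h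

lemma centralCoeff_pos (k : ℕ) : 0 < centralCoeff k :=
  div_pos (by exact_mod_cast Nat.centralBinom_pos k) (by positivity)

/-- The power series of `(1 - t)^(-1/2)`. -/
def invSqrtSeries : PowerSeries ℝ := PowerSeries.mk centralCoeff

lemma polyE_eq_sum (m : ℕ) (x : ℝ) :
    polyE m x = ∑ p ∈ Finset.HasAntidiagonal.antidiagonal m,
      centralCoeff p.1 * x ^ p.1 * centralCoeff p.2 := by
  rw [Finset.Nat.sum_antidiagonal_eq_sum_range_succ_mk, polyE, Finset.mul_sum]
  refine Finset.sum_congr rfl fun k hk => ?_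
  have hk' : k ≤ m := Nat.lt_succ_iff.1 (Finset.mem_range.1 hk)
  obtain ⟨l, rfl⟩ := Nat.exists_eq_add_of_le hk'
  have h1 : 2 * (k + l) - 2 * k = 2 * l := by omega
  simp only [centralCoeff, Nat.centralBinom, h1, Nat.add_sub_cancel_left, pow_add]
  field_simp

lemma polyE_eq_coeff (m : ℕ) (x : ℝ) :
    polyE m x = PowerSeries.coeff m (PowerSeries.rescale x invSqrtSeries * invSqrtSeries) := by
  rw [polyE_eq_sum, PowerSeries.coeff_mul]
  refine Finset.sum_congr rfl fun p _ => ?_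
  simp [invSqrtSeries, PowerSeries.coeff_rescale, mul_comm]

/-- The differential equation `2(1 - xt) f' = x f` of `f = (1 - xt)^(-1/2)`; coefficientwise it is
`centralCoeff_succ`. -/
lemma derivative_rescale_invSqrtSeries (x : ℝ) :
    2 * (1 - PowerSeries.C x * PowerSeries.X) *
        PowerSeries.derivative ℝ (PowerSeries.rescale x invSqrtSeries) =
      PowerSeries.C x * PowerSeries.rescale x invSqrtSeries := by
  have h2 : (2 : PowerSeries ℝ) = PowerSeries.C 2 := (map_ofNat PowerSeries.C 2).symm
  ext n
  rw [h2, mul_assoc, sub_mul, one_mul, mul_assoc, PowerSeries.coeff_C_mul, map_sub,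
    PowerSeries.coeff_C_mul, PowerSeries.coeff_C_mul]
  cases n with
  | zero =>
    have := centralCoeff_succ 0
    simp [PowerSeries.coeff_derivative, PowerSeries.coeff_rescale, invSqrtSeries] at this ⊢
    linear_combination x * this
  | succ n =>
    have := centralCoeff_succ (n + 1)
    rw [PowerSeries.coeff_succ_X_mul]
    simp [PowerSeries.coeff_derivative, PowerSeries.coeff_rescale, invSqrtSeries] at this ⊢
    linear_combination x ^ (n + 2) * this

/-- By the product rule, `F = ((1 - t)(1 - xt))^(-1/2)` satisfies `2(1 - t)(1 - xt) F' = (1 + x -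
2xt) F`; the recurrence is its coefficient of `t^(m+1)`. -/
lemma polyE_recurrence (m : ℕ) (x : ℝ) :
    2 * ((m : ℝ) + 2) * polyE (m + 2) x =
      (2 * m + 3) * (1 + x) * polyE (m + 1) x - 2 * (m + 1) * x * polyE m x := by
  have h1 := derivative_rescale_invSqrtSeries 1
  have hx := derivative_rescale_invSqrtSeries x
  simp only [PowerSeries.rescale_one, RingHom.id_apply, map_one, one_mul] at h1
  have key : 2 * (PowerSeries.derivative ℝ (PowerSeries.rescale x invSqrtSeries * invSqrtSeries)
        - PowerSeries.C (1 + x) * (PowerSeries.X *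
          PowerSeries.derivative ℝ (PowerSeries.rescale x invSqrtSeries * invSqrtSeries))
        + PowerSeries.C x * (PowerSeries.X * (PowerSeries.X *
          PowerSeries.derivative ℝ (PowerSeries.rescale x invSqrtSeries * invSqrtSeries)))) =
      PowerSeries.C (1 + x) * (PowerSeries.rescale x invSqrtSeries * invSqrtSeries)
        - 2 * (PowerSeries.C x * (PowerSeries.X *
          (PowerSeries.rescale x invSqrtSeries * invSqrtSeries))) := by
    simp only [Derivation.leibniz, smul_eq_mul, map_add, map_one]
    linear_combination (1 - PowerSeries.C x * PowerSeries.X) *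
      PowerSeries.rescale x invSqrtSeries * h1 +
      (1 - PowerSeries.X) * invSqrtSeries * hx
  have h2 : (2 : PowerSeries ℝ) = PowerSeries.C 2 := (map_ofNat PowerSeries.C 2).symm
  have hc := congrArg (PowerSeries.coeff (m + 1)) key
  rw [h2, map_sub, PowerSeries.coeff_C_mul, PowerSeries.coeff_C_mul, PowerSeries.coeff_C_mul,
    map_add, map_sub] at hc
  simp only [PowerSeries.coeff_C_mul, PowerSeries.coeff_succ_X_mul,
    PowerSeries.coeff_derivative] at hc
  cases m with
  | zero =>
    simp only [PowerSeries.coeff_zero_X_mul,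
      ← polyE_eq_coeff] at hc
    push_cast at hc ⊢
    linear_combination hc
  | succ m =>
    simp only [PowerSeries.coeff_succ_X_mul, PowerSeries.coeff_derivative,
      ← polyE_eq_coeff] at hc
    push_cast at hc ⊢
    linear_combination hc

lemma polyE_zero (x : ℝ) : polyE 0 x = 1 := by simp [polyE]

lemma polyE_one (x : ℝ) : polyE 1 x = (1 + x) / 2 := by
  simp [polyE, Finset.sum_range_succ]; ring

lemma polyE_pos (m : ℕ) {x : ℝ} (hx : 0 ≤ x) : 0 < polyE m x := by
  rw [polyE_eq_sum]
  refine Finset.sum_pos' (fun p _ => ?_) ⟨(0, m), by simp, ?_⟩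
  · have := centralCoeff_pos p.1
    have := centralCoeff_pos p.2
    positivity
  · have := centralCoeff_pos 0
    have := centralCoeff_pos m
    simp only [pow_zero, mul_one]
    positivity

lemma polyE_strictAnti {x : ℝ} (h0 : 0 ≤ x) (h1 : x < 1) : StrictAnti fun m : ℕ => polyE m x := by
  refine strictAnti_nat_of_succ_lt fun m => ?_
  induction m with
  | zero => simp only [zero_add, polyE_zero, polyE_one]; linarith
  | succ m ih =>
    -- The recurrence rearranges to `2(m+2)(E_{m+1} - E_{m+2}) = (1-x) E_{m+1} + 2(m+1)x (E_m -
    -- E_{m+1})`, a positive term plus a nonnegative one.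
    have hr := polyE_recurrence m x
    have hp := mul_pos (polyE_pos (m + 1) h0) (sub_pos.2 h1)
    have hd : 0 ≤ 2 * ((m : ℝ) + 1) * x * (polyE m x - polyE (m + 1) x) :=
      mul_nonneg (by positivity) (sub_nonneg.2 ih.le)
    have hm : (0 : ℝ) < 2 * ((m : ℝ) + 2) := by positivity
    refine lt_of_mul_lt_mul_left ?_ hm.le
    show 2 * ((m : ℝ) + 2) * polyE (m + 2) x < 2 * ((m : ℝ) + 2) * polyE (m + 1) x
    nlinarith

/-! ## The numerical constants -/

lemma sqrt385_bounds : 19.6214 < √385 ∧ √385 < 19.6215 :=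
  ⟨by rw [Real.lt_sqrt (by norm_num)]; norm_num, by rw [Real.sqrt_lt' (by norm_num)]; norm_num⟩

lemma betaC_bounds : 1.7241 < betaC ∧ betaC < 1.72411 := by
  obtain ⟨h1, h2⟩ := sqrt385_bounds
  constructor <;> rw [betaC] <;> linarith

lemma alphaC_bounds : 0.9223 < alphaC ∧ alphaC < 0.92233 := by
  obtain ⟨h1, h2⟩ := sqrt385_bounds
  constructor <;> rw [alphaC] <;> linarith

lemma alphaC_div_betaC_bounds : 0 ≤ alphaC / betaC ∧ alphaC / betaC < 0.535 := by
  obtain ⟨h1, h2⟩ := betaC_bounds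
  obtain ⟨h3, h4⟩ := alphaC_bounds
  refine ⟨div_nonneg (by linarith) (by linarith), ?_⟩
  rw [div_lt_iff₀ (by linarith)]
  linarith

lemma two_div_betaC_bounds : 1.16 < 2 / betaC ∧ 2 / betaC < 1.17 := by
  obtain ⟨h1, h2⟩ := betaC_bounds
  rw [lt_div_iff₀ (by linarith), div_lt_iff₀ (by linarith)]
  constructor <;> linarith

lemma betaC_pow_mul_lt {m : ℕ} (hm : 3 ≤ m) : betaC ^ m * 0.617 < (2 ^ m + 2) / 3 := by
  obtain ⟨h1, h2⟩ := betaC_bounds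
  have hb : 0 < betaC := by linarith
  induction m, hm using Nat.le_induction with
  | base =>
    have : betaC ^ 3 ≤ 1.72411 ^ 3 := by gcongr
    norm_num at this ⊢
    linarith
  | succ m hm ih =>
    -- The step needs `β(2ᵐ + 2) ≤ 2·2ᵐ + 2`, that is `(2 - β)2ᵐ ≥ 2β - 2`. This holds from `m = 3`
    -- on but fails at `m = 2`.
    have h8 : (2 : ℝ) ^ 3 ≤ 2 ^ m := pow_le_pow_right₀ (by norm_num) hm
    rw [pow_succ, pow_succ]
    nlinarith

lemma betaC_pow_mul_polyE_lt {m : ℕ} (hm : 1 ≤ m) :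
    betaC ^ m * polyE m (alphaC / betaC) < (2 ^ m + 2) / 3 := by
  obtain ⟨h1, h2⟩ := betaC_bounds
  obtain ⟨h3, h4⟩ := alphaC_bounds
  obtain ⟨h5, h6⟩ := alphaC_div_betaC_bounds
  have hb : 0 < betaC := by linarith
  have hE1 := polyE_one (alphaC / betaC)
  -- `E_2(x) = (3 + 2x + 3x²)/8`, which is about `0.6161` at `x = 0.535`.
  have hE2 : polyE 2 (alphaC / betaC) < 0.617 := by
    have hr := polyE_recurrence 0 (alphaC / betaC)
    rw [hE1, polyE_zero] at hr
    norm_num at hr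
    nlinarith
  obtain rfl | hm2 := hm.eq_or_lt
  · rw [hE1, pow_one, ← mul_div_assoc, mul_add, mul_div_cancel₀ _ hb.ne']
    linarith
  have hle : polyE m (alphaC / betaC) < 0.617 :=
    lt_of_le_of_lt ((polyE_strictAnti h5 (by linarith)).antitone hm2) hE2
  obtain rfl | hm3 := (show 2 ≤ m from hm2).eq_or_lt
  · have : betaC ^ 2 < 3 := by nlinarith
    nlinarith [sq_nonneg betaC]
  · exact lt_of_le_of_lt (by gcongr) (betaC_pow_mul_lt hm3)

/-! ## Diagonal moments of a ladder operator -/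

section Ladder

variable {R E : Type*} [CommRing R] [AddCommGroup E] [Module R E]

lemma Module.End.commutator_pow {K T : Module.End R E} {τ : R}
    (h : K * T = T * K + τ • 1) (n : ℕ) :
    K * T ^ n = T ^ n * K + (n * τ) • T ^ (n - 1) := by
  induction n with
  | zero => simp
  | succ n ih =>
    rw [pow_succ, ← mul_assoc, ih, add_mul, mul_assoc, h, mul_add, ← mul_assoc, smul_mul_assoc]
    cases n with
    | zero => simp
    | succ n =>
      simp only [Nat.add_sub_cancel, ← pow_succ, mul_smul_comm, mul_one]
      rw [add_assoc, ← add_smul]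
      push_cast
      ring_nf

/-- If `T ψ = V ψ` and `K ψ = 0`, and the commutators `[T, V]` and `[K, T]` are scalars, where
`2 V = K + Kᵗ` for a symmetric bilinear form, then the Gram matrix of the vectors `Tⁿ ψ` obeys a
two-term recurrence. -/
lemma gram_recurrence (B : E →ₗ[R] E →ₗ[R] R)
    {T V K : Module.End R E} {κ σ : R} {ψ : E}
    (hB : ∀ f g, 2 * B (V f) g = B (K f) g + B f (K g))
    (hT : T ψ = V ψ) (hK : K ψ = 0) (hVT : V * T = T * V + (-κ) • 1)
    (hKT : K * T = T * K + (2 * σ) • 1) (j k : ℕ) :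
    2 * B ((T ^ (j + 1)) ψ) ((T ^ k) ψ) =
      2 * ((σ + κ) * j * B ((T ^ (j - 1)) ψ) ((T ^ k) ψ) +
        σ * k * B ((T ^ j) ψ) ((T ^ (k - 1)) ψ)) := by
  have hKn (n : ℕ) : K ((T ^ n) ψ) = (n * (2 * σ)) • (T ^ (n - 1)) ψ := by
    have := congrArg (fun S : Module.End R E => S ψ) (Module.End.commutator_pow hKT n)
    simpa [hK] using this
  -- One factor `T` becomes `V` on `ψ` and is then commuted to the left. At `j = 0` the truncated
  -- exponent `j - 1` is harmless, its coefficient being zero.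
  have hVn : (T ^ (j + 1)) ψ = V ((T ^ j) ψ) + (j * κ) • (T ^ (j - 1)) ψ := by
    have := congrArg (fun S : Module.End R E => S ψ) (Module.End.commutator_pow hVT j)
    simp only [Module.End.mul_apply, LinearMap.add_apply, LinearMap.smul_apply] at this
    rw [pow_succ, Module.End.mul_apply, hT, this, add_assoc, ← add_smul]
    simp
  rw [hVn, map_add, LinearMap.add_apply, mul_add, hB, hKn, hKn]
  simp only [map_smul, LinearMap.smul_apply, smul_eq_mul]
  ring

/-- A symmetric array with the recurrence of `gram_recurrence` has a diagonal that obeys a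
three-term recurrence. -/
lemma diagonal_recurrence {G : ℕ → ℕ → R} {r s : R} (hsymm : ∀ j k, G j k = G k j)
    (hG : ∀ j k, G (j + 1) k = r * j * G (j - 1) k + s * k * G j (k - 1)) (m : ℕ) :
    G (m + 1) (m + 1) = s * (2 * m + 1) * G m m - m ^ 2 * (s ^ 2 - r ^ 2) * G (m - 1) (m - 1) := by
  cases m with
  | zero => simpa using hG 0 1
  | succ m =>
    -- These three instances involve, up to symmetry, only the off-diagonal entries `G m (m + 2)`
    -- and `G (m - 1) (m + 1)`, which can be eliminated.
    have h1 := hG (m + 1) (m + 2)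
    have h2 := hG (m + 1) m
    have h3 := hG m (m + 1)
    simp only [Nat.add_sub_cancel, show m + 2 - 1 = m + 1 from rfl] at h1 h2 h3 ⊢
    rw [hsymm (m + 1) (m - 1)] at h2
    rw [show m + 1 + 1 = m + 2 from rfl] at h1 h2 ⊢
    rw [hsymm m (m + 2)] at h1
    push_cast at h1 h2 h3 ⊢
    linear_combination h1 + r * (m + 1) * h2 - s * (m + 1) * h3

end Ladder

/-! ## Linear combinations of positions and of derivatives -/

/-- Multiplication by the linear form `x ↦ ∑ wᵢ xᵢ`. -/
def posComb (w : Fin 3 → ℝ) : 𝓢(Config, ℂ) →L[ℂ] 𝓢(Config, ℂ) :=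
  ∑ i, (w i : ℂ) • positionOp i

/-- The derivative `∑ wᵢ ∂ᵢ` in the direction `w`. -/
def derivComb (w : Fin 3 → ℝ) : 𝓢(Config, ℂ) →L[ℂ] 𝓢(Config, ℂ) :=
  ∑ i, (w i : ℂ) • partialOp i

lemma posComb_apply (w : Fin 3 → ℝ) (f : 𝓢(Config, ℂ)) (x : Config) :
    posComb w f x = ((w ⬝ᵥ x.ofLp : ℝ) : ℂ) * f x := by
  simp [posComb, positionOp_apply, dotProduct, Fin.sum_univ_three]
  ring

lemma derivComb_apply (w : Fin 3 → ℝ) (f : 𝓢(Config, ℂ)) (x : Config) :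
    derivComb w f x = fderiv ℝ f x (WithLp.toLp 2 w) := by
  have hw : WithLp.toLp 2 w = ∑ i, w i • EuclideanSpace.single i (1 : ℝ) := by
    ext j
    fin_cases j <;> simp [Fin.sum_univ_three]
  rw [hw, map_sum]
  simp [derivComb, partialOp_apply, f.differentiableAt.lineDeriv_eq_fderiv, Fin.sum_univ_three]

lemma derivComb_eq_lineDerivOp (w : Fin 3 → ℝ) (f : 𝓢(Config, ℂ)) :
    derivComb w f = ∂_{(WithLp.toLp 2 w : Config)} f := by
  ext x
  rw [derivComb_apply, SchwartzMap.lineDerivOp_apply_eq_fderiv]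

lemma posComb_comm (v w : Fin 3 → ℝ) (f : 𝓢(Config, ℂ)) :
    posComb v (posComb w f) = posComb w (posComb v f) := by
  ext x
  simp only [posComb_apply]
  ring

lemma derivComb_comm (v w : Fin 3 → ℝ) (f : 𝓢(Config, ℂ)) :
    derivComb v (derivComb w f) = derivComb w (derivComb v f) := by
  ext x
  have hd : DifferentiableAt ℝ (fderiv ℝ f) x :=
    ((f.smooth 2).fderiv_right (m := 1) le_rfl).differentiable one_ne_zero |>.differentiableAt
  have h (v w : Fin 3 → ℝ) : derivComb v (derivComb w f) x =
      fderiv ℝ (fderiv ℝ f) x (WithLp.toLp 2 v) (WithLp.toLp 2 w) := by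
    rw [derivComb_apply]
    have : (derivComb w f : Config → ℂ) = fun y => fderiv ℝ f y (WithLp.toLp 2 w) :=
      funext (derivComb_apply w f)
    rw [this, fderiv_clm_apply hd (differentiableAt_const _)]
    simp
  rw [h, h]
  exact ((f.smooth 2).contDiffAt.isSymmSndFDerivAt (by simp)).eq _ _

/-- The canonical commutation relation, source of every scalar commutator below. -/
lemma derivComb_posComb (v w : Fin 3 → ℝ) (f : 𝓢(Config, ℂ)) :
    derivComb v (posComb w f) = posComb w (derivComb v f) + ((v ⬝ᵥ w : ℝ) : ℂ) • f := by
  ext x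
  have hl : HasFDerivAt (fun y : Config => ((w ⬝ᵥ y.ofLp : ℝ) : ℂ))
      (∑ i, (w i : ℂ) • Complex.ofRealCLM ∘L (EuclideanSpace.proj i : Config →L[ℝ] ℝ)) x := by
    have : (fun y : Config => ((w ⬝ᵥ y.ofLp : ℝ) : ℂ)) =
        ⇑(∑ i, (w i : ℂ) • Complex.ofRealCLM ∘L (EuclideanSpace.proj i : Config →L[ℝ] ℝ)) := by
      ext y
      simp [dotProduct]
    rw [this]
    exact ContinuousLinearMap.hasFDerivAt _
  have hm : (posComb w f : Config → ℂ) = fun y => ((w ⬝ᵥ y.ofLp : ℝ) : ℂ) * f y :=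
    funext (posComb_apply w f)
  rw [derivComb_apply, hm]
  refine (congrArg (fun l => l (WithLp.toLp 2 v))
    (hl.mul f.differentiableAt.hasFDerivAt).fderiv).trans ?_
  simp [posComb_apply, derivComb_apply, dotProduct, Fin.sum_univ_three]
  ring

/-- The symmetric bilinear form `(f, g) ↦ ∫ f g`. -/
def integralForm : 𝓢(Config, ℂ) →ₗ[ℂ] 𝓢(Config, ℂ) →ₗ[ℂ] ℂ :=
  LinearMap.mk₂ ℂ (fun f g => ∫ x : Config, f x * g x)
    (fun f₁ f₂ g => by
      simp only [add_apply, add_mul]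
      exact MeasureTheory.integral_add
        (SchwartzMap.pairing (ContinuousLinearMap.mul ℝ ℂ) f₁ g).integrable
        (SchwartzMap.pairing (ContinuousLinearMap.mul ℝ ℂ) f₂ g).integrable)
    (fun c f g => by
      simp only [smul_apply, smul_mul_assoc]
      exact MeasureTheory.integral_smul _ _)
    (fun f g₁ g₂ => by
      simp only [add_apply, mul_add]
      exact MeasureTheory.integral_add
        (SchwartzMap.pairing (ContinuousLinearMap.mul ℝ ℂ) f g₁).integrable
        (SchwartzMap.pairing (ContinuousLinearMap.mul ℝ ℂ) f g₂).integrable)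
    (fun c f g => by
      simp only [smul_apply, mul_smul_comm]
      exact MeasureTheory.integral_smul _ _)

lemma integralForm_apply (f g : 𝓢(Config, ℂ)) : integralForm f g = ∫ x : Config, f x * g x := rfl

lemma integralForm_symm (f g : 𝓢(Config, ℂ)) : integralForm f g = integralForm g f := by
  simp only [integralForm_apply, mul_comm]

lemma integralForm_posComb (w : Fin 3 → ℝ) (f g : 𝓢(Config, ℂ)) :
    integralForm (posComb w f) g = integralForm f (posComb w g) := by
  simp only [integralForm_apply, posComb_apply, mul_left_comm, mul_assoc]

lemma integralForm_derivComb (w : Fin 3 → ℝ) (f g : 𝓢(Config, ℂ)) :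
    integralForm (derivComb w f) g = -integralForm f (derivComb w g) := by
  simp only [integralForm_apply, derivComb_eq_lineDerivOp]
  rw [SchwartzMap.integral_mul_lineDerivOp_right_eq_neg_left, neg_neg]

/-- The operator `u · x + c · ∂`. -/
def ladderOp (u c : Fin 3 → ℝ) : 𝓢(Config, ℂ) →L[ℂ] 𝓢(Config, ℂ) := posComb u + derivComb c

/-- Positions are symmetric and derivatives antisymmetric for the form, so transposition flips the
sign of `c`. -/
lemma integralForm_ladderOp_pow (u c : Fin 3 → ℝ) (m : ℕ) (f g : 𝓢(Config, ℂ)) :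
    integralForm f ((ladderOp u (-c) ^ m) g) = integralForm ((ladderOp u c ^ m) f) g := by
  have hneg : derivComb (-c) = -derivComb c := by simp [derivComb]
  have h (f g : 𝓢(Config, ℂ)) :
      integralForm f (ladderOp u (-c) g) = integralForm (ladderOp u c f) g := by
    simp only [ladderOp, hneg, add_apply, map_add, LinearMap.add_apply,
      integralForm_posComb, integralForm_derivComb, neg_apply, map_neg]
  induction m generalizing f with
  | zero => simp
  | succ m ih =>
    rw [pow_succ', mul_apply_eq_comp, h, ih, pow_succ, mul_apply_eq_comp]

/-! ## Moments of a real Gaussian state -/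

section Gaussian

variable {A : Matrix (Fin 3) (Fin 3) ℝ} (hA : A.PosDef)

lemma conj_gaussianState (x : Config) : conj (gaussianState A hA x) = gaussianState A hA x := by
  rw [gaussianState_apply, Complex.conj_ofReal]

lemma derivComb_gaussianState (w : Fin 3 → ℝ) :
    derivComb w (gaussianState A hA) = -posComb (A *ᵥ w) (gaussianState A hA) := by
  have hsymm (i j : Fin 3) : A i j = A j i := by simpa using hA.isHermitian.apply j i
  ext x
  have hc (i : Fin 3) : HasFDerivAt (fun y : Config => y i)
      (EuclideanSpace.proj i : Config →L[ℝ] ℝ) x :=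
    (EuclideanSpace.proj i : Config →L[ℝ] ℝ).hasFDerivAt
  have hq : (fun y : Config => y.ofLp ⬝ᵥ (A *ᵥ y.ofLp)) =
      fun y : Config => ∑ i, ∑ j, A i j * (y i * y j) := by
    ext y
    simp only [dotProduct, Matrix.mulVec, Finset.mul_sum]
    refine Finset.sum_congr rfl fun i _ => Finset.sum_congr rfl fun j _ => by ring
  have hd : HasFDerivAt (fun y : Config => ∑ i, ∑ j, A i j * (y i * y j)) _ x :=
    HasFDerivAt.fun_sum (u := Finset.univ) fun (i : Fin 3) _ =>
    HasFDerivAt.fun_sum (u := Finset.univ) fun (j : Fin 3) _ =>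
      ((hc i).mul (hc j)).const_mul (A i j)
  rw [← hq] at hd
  have hψ : (gaussianState A hA : Config → ℂ) = fun x => ((Real.pi ^ (-(3 / 4) : ℝ) *
      A.det ^ (1 / 4 : ℝ) * Real.exp (-(1 / 2) * (x.ofLp ⬝ᵥ (A *ᵥ x.ofLp))) : ℝ) : ℂ) :=
    funext (gaussianState_apply A hA)
  have hf := Complex.ofRealCLM.hasFDerivAt.comp x ((hd.const_mul (-(1 / 2))).exp.const_mul
    (Real.pi ^ (-(3 / 4) : ℝ) * A.det ^ (1 / 4 : ℝ)))
  rw [derivComb_apply, neg_apply, posComb_apply, hψ]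
  refine (congrArg (fun l => l (WithLp.toLp 2 w)) hf.fderiv).trans ?_
  simp [Fin.sum_univ_three, Matrix.mulVec, dotProduct]
  rw [hsymm 1 0, hsymm 2 0, hsymm 2 1]
  ring

open MeasureTheory in
open scoped MatrixOrder in
lemma integral_exp_neg_quadForm (hA : A.PosDef) :
    ∫ x : Config, Real.exp (-quadForm A x) = Real.pi ^ (3 / 2 : ℝ) * A.det ^ (-(1 / 2) : ℝ) := by
  -- The substitution `y = B x` turns the quadratic form into `‖y‖²`, with Jacobian `|det B| = (det
  -- A)^(1/2)`.
  obtain ⟨B, hB⟩ : ∃ B : Matrix (Fin 3) (Fin 3) ℝ, A = Bᵀ * B :=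
    CStarAlgebra.nonneg_iff_eq_star_mul_self.mp hA.posSemidef.nonneg
  have hdet : A.det = B.det ^ 2 := by rw [hB, Matrix.det_mul, Matrix.det_transpose, sq]
  have hB0 : B.det ≠ 0 := fun h => hA.det_pos.ne' (by rw [hdet, h]; simp)
  have hT : LinearMap.det (Matrix.toLpLin 2 2 B) = B.det := by
    rw [Matrix.toLpLin_eq_toLin, LinearMap.det_toLin]
  have hq (x : Config) : quadForm A x = ‖Matrix.toLpLin 2 2 B x‖ ^ 2 := by
    rw [EuclideanSpace.real_norm_sq_eq, quadForm, hB, ← Matrix.mulVec_mulVec,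
      Matrix.dotProduct_mulVec, Matrix.vecMul_transpose]
    simp [dotProduct, sq, Matrix.toLpLin_apply]
  have hmap := Measure.map_linearMap_addHaar_eq_smul_addHaar (volume : Measure Config)
    (f := Matrix.toLpLin 2 2 B) (hT ▸ hB0)
  have hint := GaussianFourier.integral_rexp_neg_mul_sq_norm (V := Config) one_pos
  have hcont : Continuous (Matrix.toLpLin 2 2 B) :=
    LinearMap.continuous_of_finiteDimensional _
  have h := integral_map (μ := (volume : Measure Config)) hcont.aemeasurable
    (f := fun y : Config => Real.exp (-1 * ‖y‖ ^ 2)) (by fun_prop)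
  rw [hmap, integral_smul_measure, hint, hT] at h
  simp only [hq, ← neg_one_mul (‖_‖ ^ 2), ← h]
  rw [hdet, ← sq_abs, ← Real.rpow_natCast, ← Real.rpow_mul (abs_nonneg _),
    ENNReal.toReal_ofReal (abs_nonneg _), abs_inv]
  norm_num [Real.rpow_neg_one, mul_comm]

lemma integralForm_gaussianState :
    integralForm (gaussianState A hA) (gaussianState A hA) = 1 := by
  have hdet := hA.det_pos
  have h (x : Config) : gaussianState A hA x * gaussianState A hA x =
      ((Real.pi ^ (-(3 / 2) : ℝ) * A.det ^ (1 / 2 : ℝ) * Real.exp (-quadForm A x) : ℝ) : ℂ) := by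
    rw [gaussianState_apply, ← Complex.ofReal_mul, mul_mul_mul_comm,
      mul_mul_mul_comm (Real.pi ^ (-(3 / 4) : ℝ)), ← Real.rpow_add Real.pi_pos,
      ← Real.rpow_add hdet, ← Real.exp_add, quadForm]
    ring_nf
  rw [integralForm_apply]
  simp only [h]
  rw [integral_complex_ofReal, MeasureTheory.integral_const_mul, integral_exp_neg_quadForm hA,
    mul_mul_mul_comm, ← Real.rpow_add Real.pi_pos, ← Real.rpow_add hdet]
  norm_num

/-- The three-term recurrence of the moments `‖(u · x + c · ∂)ᵐ ψ‖²` of a real Gaussian state, in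
terms of the vector `d = A⁻¹ u - c`. -/
lemma gaussian_moment_recurrence {u c d : Fin 3 → ℝ} (hd : A *ᵥ d = u - A *ᵥ c) (m : ℕ) :
    let G := fun m : ℕ => integralForm ((ladderOp u c ^ m) (gaussianState A hA))
      ((ladderOp u c ^ m) (gaussianState A hA))
    let κ := c ⬝ᵥ (A *ᵥ d)
    let σ := (d ⬝ᵥ u - κ) / 2
    G (m + 1) = (σ : ℂ) * (2 * m + 1) * G m -
      m ^ 2 * ((σ : ℂ) ^ 2 - (σ + κ : ℂ) ^ 2) * G (m - 1) := by
  intro G κ σ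
  have hσ : (2 * σ : ℂ) = ((d ⬝ᵥ u : ℝ) : ℂ) - κ := by simp [σ]; ring
  -- `K = (A d) · x + d · ∂` kills `ψ` because `d · ∂ ψ = -(A d) · x ψ`. Its transpose flips the
  -- derivative, so `K + Kᵗ` is twice multiplication by `(A d) · x`.
  have hrec (j k : ℕ) := gram_recurrence integralForm (ψ := gaussianState A hA)
    (T := (ladderOp u c).toLinearMap) (V := (posComb (A *ᵥ d)).toLinearMap)
    (K := (posComb (A *ᵥ d) + derivComb d).toLinearMap) (κ := (κ : ℂ)) (σ := (σ : ℂ))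
    (fun f g => by
      simp only [ContinuousLinearMap.coe_coe, add_apply, map_add,
        LinearMap.add_apply, integralForm_derivComb, integralForm_posComb]
      ring)
    (by
      have : posComb (u - A *ᵥ c) = posComb u - posComb (A *ᵥ c) := by
        simp [posComb, sub_smul, Finset.sum_sub_distrib]
      simp only [ContinuousLinearMap.coe_coe, ladderOp, add_apply,
        derivComb_gaussianState hA, hd, this, sub_apply, ← sub_eq_add_neg])
    (by simp [derivComb_gaussianState hA])
    (by
      ext1 f
      simp only [Module.End.mul_apply, ContinuousLinearMap.coe_coe, ladderOp,
        add_apply, LinearMap.add_apply, LinearMap.smul_apply,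
        Module.End.one_apply, map_add, derivComb_posComb c, posComb_comm _ u, κ]
      module)
    (by
      ext1 f
      simp only [Module.End.mul_apply, ContinuousLinearMap.coe_coe, ladderOp,
        add_apply, LinearMap.add_apply, LinearMap.smul_apply,
        Module.End.one_apply, map_add, derivComb_posComb, posComb_comm _ u, derivComb_comm d c,
        hσ, κ]
      module) j k
  have hdiag := diagonal_recurrence
    (G := fun j k => integralForm (((ladderOp u c).toLinearMap ^ j) (gaussianState A hA))
      (((ladderOp u c).toLinearMap ^ k) (gaussianState A hA))) (r := (σ + κ : ℂ)) (s := (σ : ℂ))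
    (fun _ _ => integralForm_symm _ _)
    (fun j k => mul_left_cancel₀ two_ne_zero (hrec j k)) m
  have hpow (n : ℕ) : ((ladderOp u c).toLinearMap ^ n) (gaussianState A hA) =
      (ladderOp u c ^ n) (gaussianState A hA) := by
    rw [← ContinuousLinearMap.toLinearMap_pow]; rfl
  simpa only [hpow] using hdiag

end Gaussian

/-! ## The moments of the GHZ/W state -/

/-- The vector with the entry `1` at `i` and `-1` elsewhere. -/
def signVec (i : Fin 3) : Fin 3 → ℝ := fun l => if l = i then 1 else -1

lemma annihilate_add_create_add_create {i j k : Fin 3} (hij : i ≠ j) (hik : i ≠ k) (hjk : j ≠ k) :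
    annihilate i + create j + create k = ((1 / √2 : ℝ) : ℂ) • ladderOp 1 (signVec i) := by
  have h {M : Type} [AddCommGroup M] (f : Fin 3 → M) : ∑ l, f l = f i + f j + f k := by
    fin_cases i <;> fin_cases j <;> fin_cases k <;> simp at hij hik hjk <;>
      simp [Fin.sum_univ_three] <;> abel
  rw [ladderOp, posComb, derivComb, h, h]
  simp only [annihilate, create, signVec, hij.symm, hik.symm, if_true, if_false, Pi.one_apply]
  push_cast
  module

lemma create_add_annihilate_add_annihilate {i j k : Fin 3} (hij : i ≠ j) (hik : i ≠ k)
    (hjk : j ≠ k) :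
    create i + annihilate j + annihilate k = ((1 / √2 : ℝ) : ℂ) • ladderOp 1 (-signVec i) := by
  have h {M : Type} [AddCommGroup M] (f : Fin 3 → M) : ∑ l, f l = f i + f j + f k := by
    fin_cases i <;> fin_cases j <;> fin_cases k <;> simp at hij hik hjk <;>
      simp [Fin.sum_univ_three] <;> abel
  rw [ladderOp, posComb, derivComb, h, h]
  simp only [annihilate, create, signVec, hij.symm, hik.symm, if_true, if_false, Pi.one_apply,
    Pi.neg_apply]
  push_cast
  module

lemma momentA_gaussianState {A : Matrix (Fin 3) (Fin 3) ℝ} (hA : A.PosDef) (m : ℕ)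
    {i j k : Fin 3} (hij : i ≠ j) (hik : i ≠ k) (hjk : j ≠ k) :
    momentA (gaussianState A hA) m i j k = 1 / (2 ^ m * m !) *
      integralForm ((ladderOp 1 (signVec i) ^ m) (gaussianState A hA))
        ((ladderOp 1 (signVec i) ^ m) (gaussianState A hA)) := by
  have hs : ((1 / √2 : ℝ) : ℂ) ^ m * ((1 / √2 : ℝ) : ℂ) ^ m = 1 / 2 ^ m := by
    rw [← mul_pow, ← Complex.ofReal_mul, div_mul_div_comm, Real.mul_self_sqrt zero_le_two]
    simp
  have hE (T : 𝓢(Config, ℂ) →L[ℂ] 𝓢(Config, ℂ)) : expectation (gaussianState A hA) T =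
      integralForm (gaussianState A hA) (T (gaussianState A hA)) := by
    simp only [expectation, conj_gaussianState, integralForm_apply]
  rw [momentA, create_add_annihilate_add_annihilate hij hik hjk,
    annihilate_add_create_add_create hij hik hjk, hE, smul_pow, smul_pow, smul_mul_smul_comm, hs,
    smul_apply, map_smul, mul_apply_eq_comp, integralForm_ladderOp_pow, smul_eq_mul]
  field_simp

lemma ghzwOff_three_halves : ghzwOff (3 / 2) = (5 + √385) / 24 := by
  have h : √(((3 / 2 : ℝ) ^ 2 - 1) * (9 * (3 / 2) ^ 2 - 1)) = √385 / 4 := by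
    rw [show ((3 / 2 : ℝ) ^ 2 - 1) * (9 * (3 / 2) ^ 2 - 1) = 385 / 4 ^ 2 by norm_num,
      Real.sqrt_div (by norm_num), Real.sqrt_sq (by norm_num)]
  rw [ghzwOff, h]
  ring

lemma ghzwMatrix_mulVec (i : Fin 3) :
    ghzwMatrix (3 / 2) *ᵥ (fun l => (23 - √385) / 12 - signVec i l) =
      1 - ghzwMatrix (3 / 2) *ᵥ signVec i := by
  have hs : √385 ^ 2 = 385 := Real.sq_sqrt (by norm_num)
  -- The all-ones vector is an eigenvector with eigenvalue `a + 2e₊ = (23 + √385)/12`, whose inverse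
  -- is `(23 - √385)/12`.
  have h1 : ghzwMatrix (3 / 2) *ᵥ (fun _ => (23 - √385) / 12) = 1 := by
    ext l
    fin_cases l <;> simp [ghzwMatrix, Matrix.mulVec, dotProduct, Fin.sum_univ_three,
      ghzwOff_three_halves] <;> linear_combination (-1 / 144) * hs
  rw [← h1, ← Matrix.mulVec_sub]
  rfl

/-- Here `d · u = 2α` and `κ = -2β`, so `σ = α + β`, `σ + κ = α - β` and `σ² - (σ + κ)² = 4αβ`. -/
lemma ghzw_moment_recurrence (i : Fin 3) (m : ℕ) :
    let G := fun m : ℕ => integralForm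
      ((ladderOp 1 (signVec i) ^ m) (ghzwState (3 / 2) (by norm_num)))
      ((ladderOp 1 (signVec i) ^ m) (ghzwState (3 / 2) (by norm_num)))
    G (m + 1) = ((alphaC + betaC : ℝ) : ℂ) * (2 * m + 1) * G m -
      m ^ 2 * ((4 * alphaC * betaC : ℝ) : ℂ) * G (m - 1) := by
  intro G
  have h := gaussian_moment_recurrence (ghzwMatrix_posDef (a := 3 / 2) (by norm_num))
    (ghzwMatrix_mulVec i) m
  have hκ : signVec i ⬝ᵥ (ghzwMatrix (3 / 2) *ᵥ (fun l => (23 - √385) / 12 - signVec i l)) =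
      -2 * betaC := by
    rw [ghzwMatrix_mulVec]
    fin_cases i <;> simp [ghzwMatrix, dotProduct, Fin.sum_univ_three,
      ghzwOff_three_halves, signVec, betaC] <;> ring
  have hd : (fun l => (23 - √385) / 12 - signVec i l) ⬝ᵥ 1 = 2 * alphaC := by
    fin_cases i <;> simp [dotProduct, Fin.sum_univ_three, signVec, alphaC] <;> ring
  rw [hκ, hd] at h
  have h' : G (m + 1) = (((2 * alphaC - -2 * betaC) / 2 : ℝ) : ℂ) * (2 * m + 1) * G m -
      m ^ 2 * ((((2 * alphaC - -2 * betaC) / 2 : ℝ) : ℂ) ^ 2 -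
        ((((2 * alphaC - -2 * betaC) / 2 : ℝ) : ℂ) + ((-2 * betaC : ℝ) : ℂ)) ^ 2) * G (m - 1) := h
  rw [h']
  generalize G m = g, G (m - 1) = g'
  push_cast
  ring

lemma ghzw_moment (i : Fin 3) (m : ℕ) :
    integralForm ((ladderOp 1 (signVec i) ^ m) (ghzwState (3 / 2) (by norm_num)))
      ((ladderOp 1 (signVec i) ^ m) (ghzwState (3 / 2) (by norm_num))) =
      ((2 ^ m * m ! * (betaC ^ m * polyE m (alphaC / betaC)) : ℝ) : ℂ) := by
  have hb : betaC ≠ 0 := by linarith [betaC_bounds.1]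
  have h0 : integralForm ((ladderOp 1 (signVec i) ^ 0) (ghzwState (3 / 2) (by norm_num)))
      ((ladderOp 1 (signVec i) ^ 0) (ghzwState (3 / 2) (by norm_num))) = 1 :=
    integralForm_gaussianState _
  have hx : betaC * (alphaC / betaC) = alphaC := mul_div_cancel₀ _ hb
  induction m using Nat.twoStepInduction with
  | zero => rw [h0]; simp [polyE_zero]
  | one =>
    have h := ghzw_moment_recurrence i 0
    simp only [zero_add] at h
    rw [h, h0, polyE_one]
    generalize alphaC / betaC = x at *
    rw [← hx]
    push_cast
    simp
    ring
  | more m ih0 ih1 =>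
    have h := ghzw_moment_recurrence i (m + 1)
    simp only [Nat.add_sub_cancel] at h
    rw [h, ih0, ih1, ← sub_eq_zero]
    have hr := polyE_recurrence m (alphaC / betaC)
    rw [show m + 2 = m + 1 + 1 from rfl, Nat.factorial_succ (m + 1), Nat.factorial_succ m]
    -- With `x` opaque and `α` rewritten as `βx`, the goal is polynomial and no division remains.
    generalize alphaC / betaC = x at *
    rw [← hx]
    norm_cast
    push_cast at hr ⊢
    rw [show m + 1 + 1 = m + 2 from rfl]
    linear_combination -(2 ^ (m + 1) * (m + 1) * m ! * betaC ^ (m + 2)) * hr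

lemma momentS_ghzwState (m : ℕ) : momentS (ghzwState (3 / 2) (by norm_num)) m =
    ((betaC ^ m * polyE m (alphaC / betaC) : ℝ) : ℂ) := by
  have h {i j k : Fin 3} (hij : i ≠ j) (hik : i ≠ k) (hjk : j ≠ k) :
      momentA (ghzwState (3 / 2) (by norm_num)) m i j k =
        ((betaC ^ m * polyE m (alphaC / betaC) : ℝ) : ℂ) := by
    have hm : (m ! : ℂ) ≠ 0 := by exact_mod_cast m.factorial_ne_zero
    refine (momentA_gaussianState _ m hij hik hjk).trans ?_
    refine (congrArg _ (ghzw_moment i m)).trans ?_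
    push_cast
    field_simp
  rw [momentS, h (by decide) (by decide) (by decide), h (by decide) (by decide) (by decide),
    h (by decide) (by decide) (by decide)]
  ring

end

theorem mainTheorem4 :
    (∀ m : ℕ, momentS (ghzwState (3 / 2) (by norm_num)) m =
      ((betaC ^ m * polyE m (alphaC / betaC) : ℝ) : ℂ)) ∧
    (0 ≤ alphaC / betaC ∧ alphaC / betaC < 1) ∧
    (∀ x : ℝ, 0 ≤ x → x < 1 → StrictAnti fun m : ℕ => polyE m x) ∧
    (∀ m : ℕ, 1 ≤ m →
      (momentS (ghzwState (3 / 2) (by norm_num)) m).re < (2 ^ m + 2) / 3) ∧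
    (∃ C : ℝ, 0 < C ∧ ∀ m : ℕ, 1 ≤ m →
      C * (2 / betaC) ^ m ≤
        ((2 ^ m + 2) / 3) / (momentS (ghzwState (3 / 2) (by norm_num)) m).re) ∧
    (1.16 < 2 / betaC ∧ 2 / betaC < 1.17) := by
  obtain ⟨hx0, hx1⟩ := alphaC_div_betaC_bounds
  have hx1' : alphaC / betaC < 1 := by linarith
  have hb : 0 < betaC := by linarith [betaC_bounds.1]
  refine ⟨momentS_ghzwState, ⟨hx0, hx1'⟩, fun x h0 h1 => polyE_strictAnti h0 h1, fun m hm => ?_,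
    ⟨1 / 3, by norm_num, fun m hm => ?_⟩, two_div_betaC_bounds⟩
  · rw [momentS_ghzwState, Complex.ofReal_re]
    exact betaC_pow_mul_polyE_lt hm
  · have hp := polyE_pos m hx0
    have hle : polyE m (alphaC / betaC) ≤ 1 :=
      polyE_zero (alphaC / betaC) ▸ (polyE_strictAnti hx0 hx1').antitone (Nat.zero_le m)
    -- The constant `1/3` comes from `E_m ≤ 1` and from dropping the `+ 2` in the bound.
    rw [momentS_ghzwState, Complex.ofReal_re, le_div_iff₀ (by positivity), div_pow]
    calc 1 / 3 * (2 ^ m / betaC ^ m) * (betaC ^ m * polyE m (alphaC / betaC))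
        = 2 ^ m / 3 * polyE m (alphaC / betaC) := by field_simp
      _ ≤ 2 ^ m / 3 * 1 := by gcongr
      _ ≤ (2 ^ m + 2) / 3 := by linarith
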